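/- Let $d\ge 1$ and $n\ge 0$ be integers, and let $X_1,X_2,\dots$ be i.i.d. random vectors in $\mathbb R^d$ satisfying (H) $\mathbb P(X_1\in h)=0$ for every affine hyperplane $h\subset\mathbb R^d$. Let $S_0:=0$, $S_k:=X_1+\dots+X_k$ be the corresponding random walk, let $C_n:=\operatorname{conv}(S_0,S_1,\dots,S_n)$ be the convex hull of its first $n$ steps including the origin, and let $(S^{(1)}_k)_{k\ge 0},\dots,(S^{(d)}_k)_{k\ge 0}$ be independent copies of the walk $(S_k)_{k\ge 0}$. Then $\operatorname{Vol}_d(C_n)$ is a random variable, and, as an equality in $[0,\infty]$, $$ \mathbb E\operatorname{Vol}_d(C_n)=\frac1{d!}\sum_{\substack{j_1+\dots+j_d\le n\\ j_1,\dots,j_d\ge 1}}\frac{\mathbb E\left|\det\left[S^{(1)}_{j_1},\dots,S^{(d)}_{j_d}\right]\right|}{j_1\cdots j_d}, $$ where $\operatorname{Vol}_d$ is Lebesgue measure on $\mathbb R^d$ and $[x_1,\dots,x_d]$ is the $d\times d$ matrix with columns $x_1,\dots,x_d$. No moment assumption is made: both sides may equal $+\infty$. -/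

import Mathlib

open MeasureTheory ProbabilityTheory
open scoped ENNReal Nat

/-- The random walk `S k = X 0 + ⋯ + X (k - 1)` with increments `X 0, X 1, …`; it starts at
`S 0 = 0`. -/
noncomputable def randomWalk {Ω : Type*} {d : ℕ} (X : ℕ → Ω → EuclideanSpace ℝ (Fin d))
    (k : ℕ) (ω : Ω) : EuclideanSpace ℝ (Fin d) :=
  ∑ i ∈ Finset.range k, X i ω

/-- The convex hull of the first `n` steps of a path, including the starting point:
`conv (S 0, S 1, …, S n)`. -/
def pathHull {Ω : Type*} {d : ℕ} (S : ℕ → Ω → EuclideanSpace ℝ (Fin d)) (n : ℕ) (ω : Ω) :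
    Set (EuclideanSpace ℝ (Fin d)) :=
  convexHull ℝ {x | ∃ k ≤ n, x = S k ω}

/-- Affine hyperplanes of `ℝ^d`: the level sets of the functionals `⟨u, ·⟩` with `u ≠ 0`. -/
def IsAffineHyperplane {d : ℕ} (h : Set (EuclideanSpace ℝ (Fin d))) : Prop :=
  ∃ u : EuclideanSpace ℝ (Fin d), u ≠ 0 ∧ ∃ c : ℝ, h = {x | inner ℝ u x = c}

/-- The `d × d` matrix whose `m`-th column is the vector `v m`. -/
def columnMatrix {d : ℕ} (v : Fin d → EuclideanSpace ℝ (Fin d)) : Matrix (Fin d) (Fin d) ℝ :=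
  Matrix.of fun i m => v m i

/-- The tuples `(j_1, …, j_d)` of integers `j_m ≥ 1` such that `j_1 + ⋯ + j_d ≤ n`. -/
def stepTuples (d n : ℕ) : Finset (Fin d → ℕ) :=
  {j ∈ Fintype.piFinset fun _ => Finset.Icc 1 n | ∑ m, j m ≤ n}

/-! The core is an identity for deterministic steps. Summed over all permutations of the first `n`
steps, the hull volume is `1/d!` times the sum of the `|det|` of the sums over `d` consecutive
blocks of lengths `j_1, …, j_d`, weighted by `1/(j_1 ⋯ j_d)`. `map_volume_walkHull` proves this for
any permutation-invariant linear functional, by induction on `d` and, inside, on `n`.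

Extend `n + 1` steps with sum `v` periodically. A window of `n + 1` points gains volume when the
preceding point is added. Over one period these gains telescope
(`convexHull_insert_diff_eq_sweep_diff`, `sum_volume_walkHull_cyclicShift`) to the volume of one
period of the hull swept along `v`, that is, `|v|` times the volume of its projection along `v`. The
projection is the hull of a walk one dimension lower, so the induction hypothesis applies.
Determinants reduce in the same way, since column operations turn one block sum into `v`
(`abs_det_blockMatrix_snoc`). Averaging cyclically over the tuples turns the surplus weight `j_last`
into `(n + 1)/(d + 1)`, which completes the factorial.

Probability enters last: the steps are exchangeable, and sums over disjoint blocks are independent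
with the laws of the `S^(m)` at times `j_m`. The pointwise identity has finite nonnegative terms, so
it integrates in `[0, ∞]` without moments. -/

open scoped Pointwise Matrix

/-! ### Sweeping a convex set along a vector. -/

section Sweep

variable {E : Type*} [AddCommGroup E] [Module ℝ E]

/-- The set swept out by `K` when it is moved in the direction `v`. -/
def sweep (K : Set E) (v : E) : Set E := {y | ∃ t : ℝ, 0 ≤ t ∧ y - t • v ∈ K}

lemma subset_sweep (K : Set E) (v : E) : K ⊆ sweep K v :=
  fun y hy => ⟨0, le_rfl, by simpa using hy⟩

lemma sweep_mono {K L : Set E} (h : K ⊆ L) (v : E) : sweep K v ⊆ sweep L v :=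
  fun _ ⟨t, ht, hy⟩ => ⟨t, ht, h hy⟩

lemma sweep_sweep (K : Set E) (v : E) : sweep (sweep K v) v ⊆ sweep K v := by
  rintro y ⟨t, ht, s, hs, hy⟩
  refine ⟨s + t, by positivity, ?_⟩
  convert hy using 1
  module

lemma Convex.sweep {K : Set E} (hK : Convex ℝ K) (v : E) : Convex ℝ (sweep K v) := by
  rintro x ⟨s, hs, hx⟩ y ⟨t, ht, hy⟩ a b ha hb hab
  refine ⟨a * s + b * t, by positivity, ?_⟩
  convert hK hx hy ha hb hab using 1
  module

lemma image_sweep {F : Type*} [AddCommGroup F] [Module ℝ F] (A : E →ₗ[ℝ] F) (K : Set E) (v : E) :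
    A '' sweep K v = sweep (A '' K) (A v) := by
  ext y
  constructor
  · rintro ⟨z, ⟨t, ht, hz⟩, rfl⟩
    exact ⟨t, ht, ⟨_, hz, by simp⟩⟩
  · rintro ⟨t, ht, z, hz, hy⟩
    refine ⟨z + t • v, ⟨t, ht, by simpa using hz⟩, ?_⟩
    simp [hy]

lemma sweep_image_add_right (K : Set E) (v w : E) :
    sweep ((· + w) '' K) v = (· + w) '' sweep K v := by
  ext y
  constructor
  · rintro ⟨t, ht, z, hz, hy⟩
    refine ⟨z + t • v, ⟨t, ht, by simpa using hz⟩, ?_⟩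
    have : y = (z + w) + t • v := by simp only at hy; rw [hy]; abel
    rw [this]; simp only; abel
  · rintro ⟨z, ⟨t, ht, hz⟩, rfl⟩
    exact ⟨t, ht, _, hz, by simp only; abel⟩

variable (M : Set E) (p v : E)

lemma convexHull_insert_add_subset_sweep :
    convexHull ℝ (insert p (insert (p + v) M)) ⊆ sweep (convexHull ℝ (insert p M)) v := by
  refine convexHull_min ?_ ((convex_convexHull ℝ _).sweep v)
  have hp : p ∈ convexHull ℝ (insert p M) := subset_convexHull ℝ _ (by simp)
  refine Set.insert_subset (subset_sweep _ _ hp) (Set.insert_subset ⟨1, zero_le_one, by simpa⟩ ?_)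
  exact (Set.subset_insert _ _).trans ((subset_convexHull ℝ _).trans (subset_sweep _ _))

lemma sweep_convexHull_insert_add_subset :
    sweep (convexHull ℝ (insert (p + v) M)) v ⊆ sweep (convexHull ℝ (insert p M)) v :=
  (sweep_mono ((convexHull_mono (Set.subset_insert _ _)).trans
    (convexHull_insert_add_subset_sweep M p v)) v).trans (sweep_sweep _ _)

/-- Adding the point `p` to a hull that contains `p + v` adds the same set to the hull as
replacing `p + v` by `p` adds to the swept hull. -/
theorem convexHull_insert_diff_eq_sweep_diff :
    convexHull ℝ (insert p (insert (p + v) M)) \ convexHull ℝ (insert (p + v) M) =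
      sweep (convexHull ℝ (insert p M)) v \ sweep (convexHull ℝ (insert (p + v) M)) v := by
  set B := convexHull ℝ (insert (p + v) M) with hB
  have hBc : Convex ℝ B := convex_convexHull ℝ _
  have hA : convexHull ℝ (insert p (insert (p + v) M)) = convexJoin ℝ {p} B :=
    convexHull_insert (Set.insert_nonempty _ _)
  have hq : p + v ∈ B := subset_convexHull ℝ _ (by simp)
  have hpM : convexHull ℝ (insert p M) ⊆ convexJoin ℝ {p} B :=
    hA ▸ convexHull_mono (Set.insert_subset_insert (Set.subset_insert _ _))
  have hAc : Convex ℝ (convexJoin ℝ {p} B) := hA ▸ convex_convexHull ℝ _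
  have hBA : B ⊆ convexJoin ℝ {p} B := hA ▸ convexHull_mono (Set.subset_insert _ _)
  have hpA : p ∈ convexJoin ℝ {p} B := hA ▸ subset_convexHull ℝ _ (by simp)
  ext y
  constructor
  · rintro ⟨hy, hyB⟩
    refine ⟨convexHull_insert_add_subset_sweep M p v hy, ?_⟩
    rintro ⟨t, ht, hyt⟩
    rw [hA, mem_convexJoin] at hy
    obtain ⟨_, hp, a, ha, l, m, hl, hm, hlm, rfl⟩ := hy
    rw [Set.mem_singleton_iff.1 hp] at hyt hyB
    -- This point is `y + l • v`. As `y - t • v` is also in `B`, convexity puts `y`, which lies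
    -- between them, in `B`.
    have ha' : l • (p + v) + m • a ∈ B := hBc hq ha hl hm hlm
    rcases (add_nonneg hl ht).eq_or_lt with h0 | h0
    · have : t = 0 := by linarith
      exact hyB (by simpa [this] using hyt)
    · apply hyB
      have := hBc hyt ha' (div_nonneg hl h0.le) (div_nonneg ht h0.le) (by field_simp)
      convert this using 1
      match_scalars <;> field_simp
      all_goals ring
  · rintro ⟨⟨t, ht, hy⟩, hyB⟩
    refine ⟨?_, fun h => hyB (subset_sweep _ _ h)⟩
    rw [hA]
    have hy' := hpM hy
    rw [mem_convexJoin] at hy'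
    obtain ⟨_, hp, a, ha, l, m, hl, hm, hlm, hya⟩ := hy'
    rw [Set.mem_singleton_iff.1 hp] at hya
    have hy2 : y = l • p + m • a + t • v := by rw [hya]; abel
    -- Pushing `l • p + m • a` by `t • v` moves weight from `p` to `p + v`. If `t ≥ l`, all of it
    -- moves and the point is in the swept `B`; otherwise weight `l - t` stays at `p`.
    rcases le_total l t with h | h
    · refine absurd ⟨t - l, by linarith, ?_⟩ hyB
      convert hBc hq ha hl hm hlm using 1
      rw [hy2]; module
    · have := hAc.sum_mem (t := Finset.univ) (w := ![m, l - t, t]) (z := ![a, p, p + v])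
        (by intro i _; fin_cases i <;> simp <;> linarith)
        (by simp [Fin.sum_univ_three]; linarith)
        (by intro i _; fin_cases i; exacts [hBA ha, hpA, hBA hq])
      convert this using 1
      rw [hy2]
      simp only [Fin.sum_univ_three, Matrix.cons_val_zero, Matrix.cons_val_one, Matrix.cons_val]
      module

end Sweep

/-! ### Volume of one period of a swept set. -/

section Volume

lemma IsCompact.isClosed_sweep {E : Type*} [NormedAddCommGroup E] [NormedSpace ℝ E]
    {K : Set E} (hK : IsCompact K) (v : E) : IsClosed (sweep K v) := by
  have : sweep K v = (fun t : ℝ => t • v) '' Set.Ici 0 + K := by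
    ext y
    simp only [Set.mem_add, Set.mem_image, sweep, Set.mem_ofPred_eq, Set.mem_Ici]
    constructor
    · rintro ⟨t, ht, hy⟩
      exact ⟨_, ⟨t, ht, rfl⟩, _, hy, by abel⟩
    · rintro ⟨_, ⟨t, ht, rfl⟩, z, hz, rfl⟩
      exact ⟨t, ht, by simpa⟩
  rw [this]
  refine IsClosed.add_right_of_isCompact ?_ hK
  rcases eq_or_ne v 0 with rfl | hv
  · have : (fun t : ℝ => t • (0 : E)) '' Set.Ici 0 = {0} := by
      ext y; simp only [smul_zero, Set.mem_image, Set.mem_singleton_iff]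
      exact ⟨fun ⟨_, _, h⟩ => h.symm, fun h => ⟨0, by simp, h.symm⟩⟩
    rw [this]; exact isClosed_singleton
  · exact (isClosedEmbedding_smul_left hv).isClosedMap _ isClosed_Ici

/-- Such a set is a half-line. It occurs as the fibre of a swept compact set in the sweeping
direction. -/
lemma volume_diff_image_add_one {s : Set ℝ} (hs : s.Nonempty) (hb : BddBelow s)
    (hup : IsUpperSet s) : volume (s \ (· + 1) '' s) = 1 := by
  apply le_antisymm
  · have : s \ (· + 1) '' s ⊆ Set.Icc (sInf s) (sInf s + 1) := by
      rintro y ⟨hy, hy'⟩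
      refine ⟨csInf_le hb hy, ?_⟩
      by_contra! h
      obtain ⟨z, hz, hzy⟩ := exists_lt_of_csInf_lt hs (show sInf s < y - 1 by linarith)
      exact hy' ⟨y - 1, hup hzy.le hz, by simp⟩
    exact (measure_mono this).trans (by simp)
  · have : Set.Ioo (sInf s) (sInf s + 1) ⊆ s \ (· + 1) '' s := by
      rintro y ⟨hy, hy'⟩
      refine ⟨?_, ?_⟩
      · obtain ⟨z, hz, hzy⟩ := exists_lt_of_csInf_lt hs hy
        exact hup hzy.le hz
      · rintro ⟨z, hz, rfl⟩
        have := csInf_le hb hz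
        linarith
    exact le_trans (by simp) (measure_mono this)

/-- Volume of a swept compact set without its translate, for the last basis vector. -/
lemma volume_sweep_single_diff {d : ℕ} {K : Set (Fin (d + 1) → ℝ)} (hK : IsCompact K) :
    volume (sweep K (Pi.single (Fin.last d) 1) \
      (· + Pi.single (Fin.last d) 1) '' sweep K (Pi.single (Fin.last d) 1)) =
      volume ((fun x : Fin (d + 1) → ℝ => Fin.init x) '' K) := by
  set e : Fin (d + 1) → ℝ := Pi.single (Fin.last d) 1 with he
  set U := sweep K e with hU
  have hUc : IsClosed U := hK.isClosed_sweep e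
  have hUm : MeasurableSet (U \ (· + e) '' U) :=
    hUc.measurableSet.diff ((Homeomorph.addRight e).isClosedMap _ hUc).measurableSet
  let f := MeasurableEquiv.piFinSuccAbove (fun _ : Fin (d + 1) => ℝ) (Fin.last d)
  have hf : MeasurePreserving f.symm (volume.prod volume) volume :=
    (volume_preserving_piFinSuccAbove (fun _ : Fin (d + 1) => ℝ) (Fin.last d)).symm f
  have hfs : ∀ t y, f.symm (t, y) = Fin.snoc y t := by
    intro t y
    simp [f, MeasurableEquiv.piFinSuccAbove, Fin.snocEquiv]
  -- Fubini: the fibre has length 1 over each point of the projection of `K` and is empty elsewhere.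
  rw [← hf.measure_preimage hUm.nullMeasurableSet,
    Measure.prod_apply_symm (f.symm.measurable hUm)]
  have hse : ∀ (y : Fin d → ℝ) (t s : ℝ), (Fin.snoc y t : Fin (d + 1) → ℝ) + s • e =
      Fin.snoc y (t + s) := by
    intro y t s
    ext i
    refine Fin.lastCases ?_ (fun i => ?_) i <;> simp [he]
  have hsec : ∀ y : Fin d → ℝ, volume ((fun t => (t, y)) ⁻¹' (f.symm ⁻¹' (U \ (· + e) '' U))) =
      ((fun x : Fin (d + 1) → ℝ => Fin.init x) '' K).indicator 1 y := by
    intro y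
    set s : Set ℝ := {t | (Fin.snoc y t : Fin (d + 1) → ℝ) ∈ U} with hs
    have h1 : (fun t => (t, y)) ⁻¹' (f.symm ⁻¹' (U \ (· + e) '' U)) = s \ (· + 1) '' s := by
      ext t
      simp only [Set.mem_preimage, Set.mem_sdiff, hs, Set.mem_ofPred_eq, hfs, Set.mem_image]
      refine and_congr_right fun _ => not_congr ⟨?_, ?_⟩
      · rintro ⟨z, hz, hzt⟩
        refine ⟨t - 1, ?_, by simp⟩
        have := hse y (t - 1) 1
        rw [one_smul, sub_add_cancel, ← hzt] at this
        rwa [add_right_cancel this]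
      · rintro ⟨r, hr, rfl⟩
        exact ⟨_, hr, by simpa using hse y r 1⟩
    have hmem : ∀ t, t ∈ s ↔ ∃ r : ℝ, 0 ≤ r ∧ (Fin.snoc y (t - r) : Fin (d + 1) → ℝ) ∈ K := by
      intro t
      simp only [hs, hU, sweep, Set.mem_ofPred_eq]
      refine exists_congr fun r => and_congr_right fun _ => ?_
      have := hse y t (-r)
      rw [neg_smul, ← sub_eq_add_neg, ← sub_eq_add_neg] at this
      rw [this]
    rw [h1]
    by_cases hy : y ∈ (fun x : Fin (d + 1) → ℝ => Fin.init x) '' K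
    · rw [Set.indicator_of_mem hy, Pi.one_apply]
      apply volume_diff_image_add_one
      · obtain ⟨x, hx, rfl⟩ := hy
        exact ⟨x (Fin.last d), (hmem _).2 ⟨0, le_rfl, by simpa [Fin.snoc_init_self] using hx⟩⟩
      · obtain ⟨b, hb⟩ := (hK.image (continuous_apply (Fin.last d))).bddBelow
        refine ⟨b, fun t ht => ?_⟩
        obtain ⟨r, hr, hrK⟩ := (hmem t).1 ht
        have := hb ⟨_, hrK, rfl⟩
        simp at this
        linarith
      · intro t t' htt' ht
        obtain ⟨r, hr, hrK⟩ := (hmem t).1 ht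
        refine (hmem t').2 ⟨r + (t' - t), by linarith, ?_⟩
        rwa [show t' - (r + (t' - t)) = t - r by ring]
    · rw [Set.indicator_of_notMem hy]
      have : s = ∅ := by
        by_contra h
        obtain ⟨t, ht⟩ := Set.nonempty_iff_ne_empty.2 h
        obtain ⟨r, hr, hrK⟩ := (hmem t).1 ht
        exact hy ⟨_, hrK, by simp⟩
      simp [this]
  simp_rw [hsec]
  rw [lintegral_indicator_one]
  have hc : Continuous fun x : Fin (d + 1) → ℝ => (Fin.init x : Fin d → ℝ) := by
    unfold Fin.init; fun_prop
  exact (hK.image hc).measurableSet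

lemma volume_sweep_diff {d : ℕ} {K : Set (Fin (d + 1) → ℝ)} (hK : IsCompact K)
    (A : (Fin (d + 1) → ℝ) ≃L[ℝ] (Fin (d + 1) → ℝ)) {v : Fin (d + 1) → ℝ}
    (hA : A v = Pi.single (Fin.last d) 1) :
    ENNReal.ofReal |LinearMap.det (A : (Fin (d + 1) → ℝ) →ₗ[ℝ] (Fin (d + 1) → ℝ))| *
      volume (sweep K v \ (· + v) '' sweep K v) =
      volume ((fun x : Fin (d + 1) → ℝ => Fin.init (A x)) '' K) := by
  have h := Measure.addHaar_image_continuousLinearEquiv volume A (sweep K v \ (· + v) '' sweep K v)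
  refine h.symm.trans ?_
  rw [← Set.image_image (fun x : Fin (d + 1) → ℝ => (Fin.init x : Fin d → ℝ)) A,
    ← volume_sweep_single_diff (hK.image A.continuous), Set.image_sdiff A.injective, ← hA]
  have hs : A '' sweep K v = sweep (A '' K) (A v) :=
    image_sweep (A : (Fin (d + 1) → ℝ) →ₗ[ℝ] (Fin (d + 1) → ℝ)) K v
  rw [← hs, Set.image_image, Set.image_image]
  simp

/-- Telescoping in terms of set differences, because swept sets may have infinite measure. -/
lemma measure_diff_eq_sum_range {α : Type*} [MeasurableSpace α] (μ : Measure α) (U : ℕ → Set α)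
    (hU : Antitone U) (hm : ∀ k, MeasurableSet (U k)) (N : ℕ) :
    μ (U 0 \ U N) = ∑ k ∈ Finset.range N, μ (U k \ U (k + 1)) := by
  induction N with
  | zero => simp
  | succ N ih =>
    rw [Finset.sum_range_succ, ← ih, ← measure_union ?_ ((hm _).diff (hm _)),
      Set.sdiff_union_sdiff_cancel (hU (Nat.zero_le _)) (hU (Nat.le_succ _))]
    exact Set.disjoint_left.2 fun x hx hx' => hx.2 hx'.1

end Volume

/-! ### Cyclic rotations of the steps. -/

section Rotation

/-- The cyclic rotation `i ↦ i + 1` modulo `N` of `{0, …, N - 1}`, extended to `ℕ` by the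
identity. -/
def cyclicShift (N : ℕ) : Equiv.Perm ℕ where
  toFun i := if i < N then (if i + 1 < N then i + 1 else 0) else i
  invFun i := if i < N then (if i = 0 then N - 1 else i - 1) else i
  left_inv i := by dsimp only; grind
  right_inv i := by dsimp only; grind

lemma cyclicShift_of_lt {N i : ℕ} (h : i < N) : cyclicShift N i = (i + 1) % N := by
  simp only [cyclicShift, Equiv.coe_fn_mk, if_pos h]
  split_ifs with h'
  · rw [Nat.mod_eq_of_lt h']
  · rw [show i + 1 = N by omega, Nat.mod_self]

lemma cyclicShift_pow_of_lt {N i : ℕ} (k : ℕ) (h : i < N) : (cyclicShift N ^ k) i = (i + k) % N := by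
  induction k with
  | zero => simp [Nat.mod_eq_of_lt h]
  | succ k ih =>
    rw [pow_succ', Equiv.Perm.mul_apply, ih, cyclicShift_of_lt (Nat.mod_lt _ (by omega))]
    simp [← add_assoc]

lemma cyclicShift_pow_of_ge {N i : ℕ} (k : ℕ) (h : N ≤ i) : (cyclicShift N ^ k) i = i := by
  induction k with
  | zero => simp
  | succ k ih =>
    rw [pow_succ', Equiv.Perm.mul_apply, ih]
    simp [cyclicShift, h.not_gt]

end Rotation

/-! ### Rotated walks as windows of a periodic path. -/

section Walk

variable {d : ℕ}

/-- The convex hull of the first `n` partial sums of `x`, including the origin. -/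
def walkHull (x : ℕ → Fin d → ℝ) (n : ℕ) : Set (Fin d → ℝ) :=
  convexHull ℝ ((fun k => ∑ i ∈ Finset.range k, x i) '' Set.Iic n)

lemma isCompact_walkHull (x : ℕ → Fin d → ℝ) (n : ℕ) : IsCompact (walkHull x n) :=
  ((Set.finite_Iic n).image _).isCompact_convexHull ℝ

lemma sum_cyclicShift_pow {E : Type*} [AddCommGroup E] (x : ℕ → E) {N m : ℕ} (k : ℕ) (hm : m ≤ N) :
    ∑ i ∈ Finset.range m, x ((cyclicShift N ^ k) i) =
      ∑ i ∈ Finset.range (k + m), x (i % N) - ∑ i ∈ Finset.range k, x (i % N) := by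
  rw [Finset.sum_range_add, add_sub_cancel_left]
  refine Finset.sum_congr rfl fun i hi => ?_
  rw [cyclicShift_pow_of_lt k (by simp at hi; omega), add_comm]

lemma sum_range_add_period {E : Type*} [AddCommGroup E] (x : ℕ → E) (N k : ℕ) :
    ∑ i ∈ Finset.range (k + N), x (i % N) =
      ∑ i ∈ Finset.range k, x (i % N) + ∑ i ∈ Finset.range N, x i := by
  rw [add_comm k, Finset.sum_range_add, add_comm]
  congr 1
  · exact Finset.sum_congr rfl fun i _ => by simp
  · exact Finset.sum_congr rfl fun i hi => by rw [Nat.mod_eq_of_lt (Finset.mem_range.1 hi)]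

/-- The walk rotated by `k` is the periodic path from time `k` on, translated to start at the
origin. -/
lemma volume_walkHull_cyclicShift_pow (x : ℕ → Fin d → ℝ) {N m : ℕ} (k : ℕ) (hm : m ≤ N) :
    volume (walkHull (fun i => x ((cyclicShift N ^ k) i)) m) =
      volume (convexHull ℝ
        ((fun k => ∑ i ∈ Finset.range k, x (i % N)) '' Set.Icc k (k + m))) := by
  set P : ℕ → Fin d → ℝ := fun k => ∑ i ∈ Finset.range k, x (i % N) with hP
  have h : P '' Set.Icc k (k + m) =
      P k +ᵥ (fun j => ∑ i ∈ Finset.range j, x ((cyclicShift N ^ k) i)) '' Set.Iic m := by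
    ext y
    simp only [Set.mem_image, Set.mem_vadd_set, Set.mem_Icc, Set.mem_Iic, exists_exists_and_eq_and,
      vadd_eq_add]
    constructor
    · rintro ⟨j, ⟨h1, h2⟩, rfl⟩
      refine ⟨j - k, by omega, ?_⟩
      rw [sum_cyclicShift_pow x k (by omega), Nat.add_sub_of_le h1]
      simp [hP]
    · rintro ⟨j, h1, rfl⟩
      refine ⟨k + j, by omega, ?_⟩
      rw [sum_cyclicShift_pow x k (by omega)]
      simp [hP]
  rw [h, convexHull_vadd, measure_vadd, walkHull]

/-- Summed over the rotations of the first `n + 1` steps, the volume that the hull gains with its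
last point is the volume of a period of the hull swept along the sum of the steps. -/
theorem sum_volume_walkHull_cyclicShift (x : ℕ → Fin d → ℝ) (n : ℕ) :
    ∑ k ∈ Finset.range (n + 1),
        (volume.real (walkHull (fun i => x ((cyclicShift (n + 1) ^ k) i)) (n + 1))
          - volume.real (walkHull (fun i => x ((cyclicShift (n + 1) ^ (k + 1)) i)) n)) =
      volume.real (sweep (walkHull x n) (∑ i ∈ Finset.range (n + 1), x i) \
        (· + ∑ i ∈ Finset.range (n + 1), x i) ''
          sweep (walkHull x n) (∑ i ∈ Finset.range (n + 1), x i)) := by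
  set v := ∑ i ∈ Finset.range (n + 1), x i with hv
  set P : ℕ → Fin d → ℝ := fun k => ∑ i ∈ Finset.range k, x (i % (n + 1)) with hP
  have hper : ∀ k, P (k + (n + 1)) = P k + v := fun k => sum_range_add_period x (n + 1) k
  set U : ℕ → Set (Fin d → ℝ) := fun k => sweep (convexHull ℝ (P '' Set.Icc k (k + n))) v with hU
  have hcomp : ∀ a b, IsCompact (convexHull ℝ (P '' Set.Icc a b)) := fun a b =>
    ((Set.finite_Icc a b).image _).isCompact_convexHull ℝ
  have hUm : ∀ k, MeasurableSet (U k) := fun k => ((hcomp _ _).isClosed_sweep v).measurableSet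
  have hleft : ∀ a b : ℕ, a ≤ b → insert a (Set.Icc (a + 1) b) = Set.Icc a b := fun a b h => by
    ext i; simp only [Set.mem_insert_iff, Set.mem_Icc]; omega
  have hright : ∀ a b : ℕ, a ≤ b + 1 → insert (b + 1) (Set.Icc a b) = Set.Icc a (b + 1) :=
    fun a b h => by ext i; simp only [Set.mem_insert_iff, Set.mem_Icc]; omega
  have e0 : ∀ k, P '' Set.Icc k (k + n) = insert (P k) (P '' Set.Icc (k + 1) (k + n)) := by
    intro k
    rw [← Set.image_insert_eq, hleft _ _ (by omega)]
  have e1 : ∀ k, P '' Set.Icc (k + 1) (k + 1 + n) =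
      insert (P k + v) (P '' Set.Icc (k + 1) (k + n)) := by
    intro k
    rw [← hper, ← Set.image_insert_eq, show k + 1 + n = k + n + 1 by ring,
      show k + (n + 1) = k + n + 1 by ring, hright _ _ (by omega)]
  have e2 : ∀ k, P '' Set.Icc k (k + (n + 1)) =
      insert (P k) (insert (P k + v) (P '' Set.Icc (k + 1) (k + n))) := by
    intro k
    rw [← e1, ← Set.image_insert_eq, hleft _ _ (by omega),
      show k + 1 + n = k + (n + 1) by ring]
  have hanti : Antitone U := antitone_nat_of_succ_le fun k => by
    simp only [hU, e0 k, e1 k]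
    exact sweep_convexHull_insert_add_subset _ _ _
  have hdiff : ∀ k, convexHull ℝ (P '' Set.Icc k (k + (n + 1))) \
      convexHull ℝ (P '' Set.Icc (k + 1) (k + 1 + n)) = U k \ U (k + 1) := by
    intro k
    simp only [hU, e0 k, e1 k, e2 k]
    exact convexHull_insert_diff_eq_sweep_diff _ _ _
  have hsub : ∀ k, convexHull ℝ (P '' Set.Icc (k + 1) (k + 1 + n)) ⊆
      convexHull ℝ (P '' Set.Icc k (k + (n + 1))) := fun k =>
    convexHull_mono (Set.image_mono (Set.Icc_subset_Icc (by omega) (by omega)))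
  -- The swept sets are unbounded in general, but each difference lies in a compact hull.
  have hlt : ∀ k, volume (U k \ U (k + 1)) ≠ ∞ := fun k => by
    rw [← hdiff]
    exact ((measure_mono Set.sdiff_subset).trans_lt (hcomp _ _).measure_lt_top).ne
  have hterm : ∀ k, volume.real (walkHull (fun i => x ((cyclicShift (n + 1) ^ k) i)) (n + 1)) -
      volume.real (walkHull (fun i => x ((cyclicShift (n + 1) ^ (k + 1)) i)) n) =
      (volume (U k \ U (k + 1))).toReal := by
    intro k
    rw [← hdiff, measureReal_def, measureReal_def, volume_walkHull_cyclicShift_pow x k le_rfl,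
      volume_walkHull_cyclicShift_pow x (k + 1) (Nat.le_succ n),
      measure_sdiff (hsub k) (hcomp _ _).measurableSet.nullMeasurableSet
        (hcomp _ _).measure_lt_top.ne,
      ENNReal.toReal_sub_of_le (measure_mono (hsub k)) (hcomp _ _).measure_lt_top.ne]
  have hU0 : U 0 = sweep (walkHull x n) v := by
    simp only [hU, walkHull]
    congr 2
    ext y
    simp only [Set.mem_image, Set.mem_Icc, Set.mem_Iic, zero_le, zero_add, true_and]
    refine exists_congr fun k => and_congr_right fun hk => ?_
    rw [hP]
    simp only
    rw [Finset.sum_congr rfl fun i hi => by rw [Nat.mod_eq_of_lt (by simp at hi; omega)]]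
  have hUN : U (n + 1) = (· + v) '' U 0 := by
    simp only [hU]
    rw [← sweep_image_add_right]
    have : P '' Set.Icc (n + 1) (n + 1 + n) = v +ᵥ P '' Set.Icc 0 (0 + n) := by
      ext y
      simp only [Set.mem_image, Set.mem_vadd_set, Set.mem_Icc, exists_exists_and_eq_and,
        vadd_eq_add]
      constructor
      · rintro ⟨j, ⟨h1, h2⟩, rfl⟩
        refine ⟨j - (n + 1), by omega, ?_⟩
        rw [add_comm, ← hper, Nat.sub_add_cancel h1]
      · rintro ⟨j, h1, rfl⟩
        exact ⟨j + (n + 1), by omega, by rw [hper, add_comm]⟩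
    rw [this, convexHull_vadd]
    congr 1
    ext y
    simp only [Set.mem_vadd_set, Set.mem_image, vadd_eq_add, add_comm]
  rw [← hU0, ← hUN, measureReal_def, measure_diff_eq_sum_range volume U hanti hUm (n + 1),
    ENNReal.toReal_sum fun k _ => hlt k]
  exact Finset.sum_congr rfl fun k _ => hterm k

end Walk

/-! ### Block sums and their determinants. -/

section Blocks

/-- The first index of the `m`-th of the consecutive blocks of lengths `j 0, j 1, …`. -/
def blockStart {d : ℕ} (j : Fin d → ℕ) (m : Fin d) : ℕ := ∑ l, if l < m then j l else 0

/-- The sum of `x` over the `m`-th of the consecutive blocks of lengths `j 0, j 1, …`. -/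
def blockSum {d : ℕ} {E : Type*} [AddCommMonoid E] (j : Fin d → ℕ) (x : ℕ → E) (m : Fin d) : E :=
  ∑ k ∈ Finset.range (j m), x (blockStart j m + k)

/-- The matrix whose columns are the block sums of `x`. -/
def blockMatrix {d : ℕ} (j : Fin d → ℕ) (x : ℕ → Fin d → ℝ) : Matrix (Fin d) (Fin d) ℝ :=
  Matrix.of fun i m => blockSum j x m i

variable {d : ℕ} {E : Type*} [AddCommGroup E]

lemma blockStart_snoc_castSucc (j : Fin d → ℕ) (r : ℕ) (m : Fin d) :
    blockStart (Fin.snoc j r : Fin (d + 1) → ℕ) m.castSucc = blockStart j m := by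
  simp [blockStart, Fin.sum_univ_castSucc, (Fin.castSucc_lt_last m).not_gt]

lemma blockStart_snoc_last (j : Fin d → ℕ) (r : ℕ) :
    blockStart (Fin.snoc j r : Fin (d + 1) → ℕ) (Fin.last d) = ∑ m, j m := by
  simp [blockStart, Fin.sum_univ_castSucc, Fin.castSucc_lt_last]

lemma blockSum_snoc_castSucc (j : Fin d → ℕ) (r : ℕ) (x : ℕ → E) (m : Fin d) :
    blockSum (Fin.snoc j r : Fin (d + 1) → ℕ) x m.castSucc = blockSum j x m := by
  simp [blockSum, blockStart_snoc_castSucc]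

lemma sum_blockSum (j : Fin d → ℕ) (x : ℕ → E) :
    ∑ m, blockSum j x m = ∑ i ∈ Finset.range (∑ m, j m), x i := by
  induction d with
  | zero => simp
  | succ d ih =>
    obtain ⟨j, r, rfl⟩ : ∃ (j' : Fin d → ℕ) (r : ℕ), j = Fin.snoc j' r :=
      ⟨Fin.init j, j (Fin.last d), (Fin.snoc_init_self j).symm⟩
    simp only [Fin.sum_univ_castSucc, blockSum_snoc_castSucc, ih, Fin.snoc_castSucc, Fin.snoc_last,
      Finset.sum_range_add]
    simp [blockSum, blockStart_snoc_last]

lemma finRotate_castSucc (m : Fin d) : finRotate (d + 1) m.castSucc = m.succ := by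
  rw [finRotate_apply, Fin.coeSucc_eq_succ]

/-- Rotating the steps by the first block rotates the blocks. -/
lemma blockSum_comp_finRotate (J : Fin (d + 1) → ℕ) (x : ℕ → E) (m : Fin (d + 1)) :
    blockSum (J ∘ finRotate (d + 1)) (fun i => x ((cyclicShift (∑ m, J m) ^ J 0) i)) m =
      blockSum J x (finRotate (d + 1) m) := by
  have hsum : ∑ m, (J ∘ finRotate (d + 1)) m = ∑ m, J m := Equiv.sum_comp (finRotate (d + 1)) J
  have hc : ∀ m : Fin d, blockSum (J ∘ finRotate (d + 1))
      (fun i => x ((cyclicShift (∑ m, J m) ^ J 0) i)) m.castSucc =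
      blockSum J x (finRotate (d + 1) m.castSucc) := by
    intro m
    have hs : J 0 + blockStart (J ∘ finRotate (d + 1)) m.castSucc = blockStart J m.succ := by
      rw [blockStart, blockStart, Fin.sum_univ_castSucc, Fin.sum_univ_succ]
      simp [(Fin.castSucc_lt_last m).not_gt]
    have hle : blockStart J m.succ + J m.succ ≤ ∑ l, J l := by
      rw [blockStart, ← Finset.add_sum_erase _ J (Finset.mem_univ m.succ), add_comm]
      gcongr
      rw [← Finset.add_sum_erase _ _ (Finset.mem_univ m.succ)]
      simp only [lt_self_iff_false, if_false, zero_add]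
      exact Finset.sum_le_sum fun l _ => by split_ifs <;> simp
    simp only [blockSum, finRotate_castSucc, Function.comp_apply]
    refine Finset.sum_congr rfl fun k hk => ?_
    rw [Finset.mem_range] at hk
    rw [cyclicShift_pow_of_lt _ (by omega), Nat.mod_eq_of_lt (by omega), ← hs]
    congr 1
    ring
  induction m using Fin.lastCases with
  | cast m => exact hc m
  | last =>
    -- The last block wraps around the period. Its sum is forced by the other blocks and the total.
    have h1 : ∀ f g : Fin (d + 1) → E, (∀ m : Fin d, f m.castSucc = g m.castSucc) →
        ∑ m, f m = ∑ m, g m → f (Fin.last d) = g (Fin.last d) := by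
      intro f g hfg h
      rw [Fin.sum_univ_castSucc, Fin.sum_univ_castSucc, Finset.sum_congr rfl fun m _ => hfg m] at h
      exact add_left_cancel h
    refine h1 _ (fun m => blockSum J x (finRotate (d + 1) m)) hc ?_
    rw [sum_blockSum, hsum, sum_cyclicShift_pow x _ le_rfl, sum_range_add_period,
      add_sub_cancel_left, ← sum_blockSum, Equiv.sum_comp (finRotate (d + 1)) (blockSum J x)]

lemma abs_det_blockMatrix_comp_finRotate (J : Fin (d + 1) → ℕ) (x : ℕ → Fin (d + 1) → ℝ) :
    |(blockMatrix (J ∘ finRotate (d + 1))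
      (fun i => x ((cyclicShift (∑ m, J m) ^ J 0) i))).det| = |(blockMatrix J x).det| := by
  have : blockMatrix (J ∘ finRotate (d + 1)) (fun i => x ((cyclicShift (∑ m, J m) ^ J 0) i)) =
      (blockMatrix J x).submatrix id (finRotate (d + 1)) := by
    ext i m
    simp [blockMatrix, blockSum_comp_finRotate]
  rw [this, Matrix.det_permute', abs_mul]
  rcases Int.units_eq_one_or (Equiv.Perm.sign (finRotate (d + 1))) with h | h <;> simp [h]

end Blocks

/-! ### Combinatorics of the tuples of block lengths. -/

section StepTuples

variable {d n : ℕ}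

lemma mem_stepTuples {j : Fin d → ℕ} :
    j ∈ stepTuples d n ↔ (∀ m, 1 ≤ j m) ∧ ∑ m, j m ≤ n := by
  simp only [stepTuples, Finset.mem_filter, Fintype.mem_piFinset, Finset.mem_Icc]
  refine ⟨fun h => ⟨fun m => (h.1 m).1, h.2⟩, fun h => ⟨fun m => ⟨h.1 m, ?_⟩, h.2⟩⟩
  exact (Finset.single_le_sum (fun _ _ => Nat.zero_le _) (Finset.mem_univ m)).trans h.2

/-- The tuples `(j_1, …, j_d)` of integers `j_m ≥ 1` such that `j_1 + ⋯ + j_d = n`. -/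
def exactTuples (d n : ℕ) : Finset (Fin d → ℕ) := {j ∈ stepTuples d n | ∑ m, j m = n}

lemma mem_exactTuples {j : Fin d → ℕ} :
    j ∈ exactTuples d n ↔ (∀ m, 1 ≤ j m) ∧ ∑ m, j m = n := by
  simp only [exactTuples, Finset.mem_filter, mem_stepTuples]
  exact ⟨fun h => ⟨h.1.1, h.2⟩, fun h => ⟨⟨h.1, h.2.le⟩, h.2⟩⟩

lemma sum_stepTuples_succ (f : (Fin d → ℕ) → ℝ) :
    ∑ j ∈ stepTuples d (n + 1), f j =
      ∑ j ∈ stepTuples d n, f j + ∑ j ∈ exactTuples d (n + 1), f j := by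
  have h : {j ∈ stepTuples d (n + 1) | ¬∑ m, j m = n + 1} = stepTuples d n := by
    ext j
    simp only [Finset.mem_filter, mem_stepTuples]
    constructor
    · rintro ⟨⟨h1, h2⟩, h3⟩; exact ⟨h1, by omega⟩
    · rintro ⟨h1, h2⟩; exact ⟨⟨h1, by omega⟩, by omega⟩
  rw [← Finset.sum_filter_add_sum_filter_not (stepTuples d (n + 1)) (fun j => ∑ m, j m = n + 1),
    h, add_comm, exactTuples]

/-- The slack `n + 1 - ∑ m, j m` is at least 1, so it serves as one more block length. This converts
sums in dimension `d` to sums in dimension `d + 1`. -/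
lemma sum_stepTuples_snoc (f : (Fin (d + 1) → ℕ) → ℝ) :
    ∑ j ∈ stepTuples d n, f (Fin.snoc j (n + 1 - ∑ m, j m)) =
      ∑ J ∈ exactTuples (d + 1) (n + 1), f J := by
  refine Finset.sum_bij' (fun j _ => Fin.snoc j (n + 1 - ∑ m, j m)) (fun J _ => Fin.init J)
    ?_ ?_ ?_ ?_ ?_
  · intro j hj
    rw [mem_stepTuples] at hj
    rw [mem_exactTuples]
    refine ⟨fun m => ?_, ?_⟩
    · refine Fin.lastCases ?_ (fun m => ?_) m
      · simp only [Fin.snoc_last]; omega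
      · simpa using hj.1 m
    · simp only [Fin.sum_univ_castSucc, Fin.snoc_castSucc, Fin.snoc_last]; omega
  · intro J hJ
    rw [mem_exactTuples, Fin.sum_univ_castSucc] at hJ
    have := hJ.1 (Fin.last d)
    rw [mem_stepTuples]
    exact ⟨fun m => hJ.1 _, by simp only [Fin.init]; omega⟩
  · intro j _; simp
  · intro J hJ
    rw [mem_exactTuples, Fin.sum_univ_castSucc] at hJ
    have : n + 1 - ∑ m, Fin.init J m = J (Fin.last d) := by simp only [Fin.init]; omega
    rw [this, Fin.snoc_init_self]
  · intro j _; rfl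

/-- For a summand invariant under rotation of the tuple, the weight `J (last d)` can be replaced
by the mean of the `J m`. -/
lemma sum_exactTuples_mul_last (b : (Fin (d + 1) → ℕ) → ℝ)
    (hb : ∀ J ∈ exactTuples (d + 1) n, b (J ∘ finRotate (d + 1)) = b J) :
    (d + 1) * ∑ J ∈ exactTuples (d + 1) n, J (Fin.last d) * b J =
      n * ∑ J ∈ exactTuples (d + 1) n, b J := by
  set c : Fin (d + 1) → ℝ := fun m => ∑ J ∈ exactTuples (d + 1) n, J m * b J with hc
  -- By rotation every coordinate gives the same weighted sum, and the coordinates add up to `n`.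
  have hrot : ∀ m, c (finRotate (d + 1) m) = c m := by
    intro m
    refine Finset.sum_equiv (Equiv.arrowCongr (finRotate (d + 1)).symm (Equiv.refl ℕ)) ?_ ?_
    · intro J
      rw [mem_exactTuples, mem_exactTuples]
      refine and_congr ⟨fun h m => h _, fun h m => ?_⟩ ?_
      · simpa using h ((finRotate (d + 1)).symm m)
      · rw [← Equiv.sum_comp (finRotate (d + 1)) J]; rfl
    · intro J hJ
      rw [← hb J hJ]; rfl
  have hconst : ∀ m, c m = c 0 := by
    intro m
    induction m using Fin.induction with
    | zero => rfl
    | succ i ih => rw [← ih, ← finRotate_castSucc, hrot]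
  calc (d + 1) * ∑ J ∈ exactTuples (d + 1) n, J (Fin.last d) * b J = ∑ m, c m := by
        rw [Finset.sum_congr rfl fun m _ => (hconst m).trans (hconst (Fin.last d)).symm]
        simp [hc]
    _ = ∑ J ∈ exactTuples (d + 1) n, ∑ m, J m * b J := Finset.sum_comm
    _ = _ := by
        rw [Finset.mul_sum]
        refine Finset.sum_congr rfl fun J hJ => ?_
        rw [← Finset.sum_mul, ← Nat.cast_sum, (mem_exactTuples.1 hJ).2]

end StepTuples

/-! ### Projection along a vector. -/

section Straighten

variable {d : ℕ}

/-- Any such map will do: the same choice enters the volume formula and the determinant formula. -/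
lemma exists_map_eq_single {v : Fin (d + 1) → ℝ} (hv : v ≠ 0) :
    ∃ A : (Fin (d + 1) → ℝ) ≃L[ℝ] (Fin (d + 1) → ℝ), A v = Pi.single (Fin.last d) 1 :=
  SeparatingDual.exists_continuousLinearEquiv_apply_eq hv (by simp)

open Classical in
/-- A linear automorphism that maps `v`, if it is nonzero, to the last basis vector. -/
noncomputable def straighten (v : Fin (d + 1) → ℝ) :
    (Fin (d + 1) → ℝ) ≃L[ℝ] (Fin (d + 1) → ℝ) :=
  if hv : v ≠ 0 then (exists_map_eq_single hv).choose else .refl ℝ _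

lemma straighten_apply {v : Fin (d + 1) → ℝ} (hv : v ≠ 0) :
    straighten v v = Pi.single (Fin.last d) 1 := by
  rw [straighten, dif_pos hv]
  exact (exists_map_eq_single hv).choose_spec

open Classical in
/-- The volume factor of `straighten v`, and zero for `v = 0`. -/
noncomputable def straightenFactor (v : Fin (d + 1) → ℝ) : ℝ :=
  if v = 0 then 0 else
    |LinearMap.det (straighten v : (Fin (d + 1) → ℝ) →ₗ[ℝ] (Fin (d + 1) → ℝ))|⁻¹

/-- The projection along `v` onto `d`-dimensional space. -/
noncomputable def shadow (v : Fin (d + 1) → ℝ) : (Fin (d + 1) → ℝ) →ₗ[ℝ] (Fin d → ℝ) :=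
  LinearMap.funLeft ℝ ℝ Fin.castSucc ∘ₗ (straighten v).toLinearMap

lemma image_walkHull {d e : ℕ} (L : (Fin d → ℝ) →ₗ[ℝ] (Fin e → ℝ)) (x : ℕ → Fin d → ℝ) (n : ℕ) :
    L '' walkHull x n = walkHull (fun i => L (x i)) n := by
  rw [walkHull, L.image_convexHull, Set.image_image, walkHull]
  simp

lemma det_straighten_ne_zero (v : Fin (d + 1) → ℝ) :
    |LinearMap.det (straighten v : (Fin (d + 1) → ℝ) →ₗ[ℝ] (Fin (d + 1) → ℝ))| ≠ 0 :=
  abs_ne_zero.2 ((straighten v).toLinearEquiv.isUnit_det'.ne_zero)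

lemma volume_sweep_walkHull_diff (x : ℕ → Fin (d + 1) → ℝ) (n : ℕ) (v : Fin (d + 1) → ℝ) :
    volume.real (sweep (walkHull x n) v \ (· + v) '' sweep (walkHull x n) v) =
      straightenFactor v * volume.real (walkHull (fun i => shadow v (x i)) n) := by
  -- For `v = 0` the set difference is empty, in agreement with `straightenFactor 0 = 0`.
  rcases eq_or_ne v 0 with rfl | hv
  · simp [straightenFactor]
  · have h := volume_sweep_diff (isCompact_walkHull x n) (straighten v) (straighten_apply hv)
    have h2 : (fun x : Fin (d + 1) → ℝ => (Fin.init (straighten v x) : Fin d → ℝ)) ''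
        walkHull x n = walkHull (fun i => shadow v (x i)) n := image_walkHull (shadow v) x n
    rw [h2] at h
    rw [measureReal_def volume (walkHull _ _), ← h, ENNReal.toReal_mul,
      ENNReal.toReal_ofReal (abs_nonneg _), straightenFactor, if_neg hv,
      inv_mul_cancel_left₀ (det_straighten_ne_zero v), measureReal_def]

/-- Adding the other columns to the last one makes it `v`. Straightening maps it to the last basis
vector, and Laplace expansion leaves the minor of projected block sums. -/
lemma abs_det_blockMatrix_snoc (x : ℕ → Fin (d + 1) → ℝ) (j : Fin d → ℕ) (r : ℕ) :
    |(blockMatrix (Fin.snoc j r : Fin (d + 1) → ℕ) x).det| =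
      straightenFactor (∑ i ∈ Finset.range (∑ m, j m + r), x i) *
        |(blockMatrix j fun i => shadow (∑ i ∈ Finset.range (∑ m, j m + r), x i) (x i)).det| := by
  set v := ∑ i ∈ Finset.range (∑ m, j m + r), x i with hv
  set M := blockMatrix (Fin.snoc j r : Fin (d + 1) → ℕ) x with hM
  have hsum : ∑ m, blockSum (Fin.snoc j r : Fin (d + 1) → ℕ) x m = v := by
    rw [sum_blockSum]
    simp [Fin.sum_univ_castSucc, hv]
  set M' := M.updateCol (Fin.last d) v with hM'
  have hdet : M'.det = M.det := by
    have h := M.det_updateCol_sum (Fin.last d) fun _ => 1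
    rw [one_smul] at h
    rw [← h, hM']
    congr 2
    ext k
    rw [← hsum]
    simp [hM, blockMatrix]
  rcases eq_or_ne v 0 with h0 | h0
  · rw [straightenFactor, if_pos h0, zero_mul, ← hdet, abs_eq_zero]
    exact Matrix.det_eq_zero_of_column_eq_zero (Fin.last d) fun i => by simp [hM', h0]
  set A := (straighten v : (Fin (d + 1) → ℝ) →ₗ[ℝ] (Fin (d + 1) → ℝ)) with hA
  have happ : ∀ i m, (LinearMap.toMatrix' A * M') i m = straighten v (fun k => M' k m) i := by
    intro i m
    have h : straighten v (fun k => M' k m) = LinearMap.toMatrix' A *ᵥ fun k => M' k m :=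
      (LinearMap.toMatrix'_mulVec A _).symm
    rw [h]
    rfl
  have hlast : ∀ i, (LinearMap.toMatrix' A * M') i (Fin.last d) =
      (Pi.single (Fin.last d) 1 : Fin (d + 1) → ℝ) i := by
    intro i
    rw [happ, ← straighten_apply h0]
    simp [hM']
  have hsub : (LinearMap.toMatrix' A * M').submatrix Fin.castSucc Fin.castSucc =
      blockMatrix j fun i => shadow v (x i) := by
    ext i m
    rw [Matrix.submatrix_apply, happ, blockMatrix, Matrix.of_apply, blockSum, ← map_sum]
    change _ = straighten v _ i.castSucc
    refine congrFun (congrArg _ ?_) _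
    ext k
    rw [hM', Matrix.updateCol_ne (Fin.castSucc_lt_last m).ne, hM, blockMatrix, Matrix.of_apply,
      blockSum_snoc_castSucc]
    rfl
  have hlap : (LinearMap.toMatrix' A * M').det = (blockMatrix j fun i => shadow v (x i)).det := by
    rw [Matrix.det_succ_column _ (Fin.last d), Finset.sum_eq_single (Fin.last d)]
    · rw [hlast, Fin.succAbove_last, hsub, Pi.single_eq_same, ← two_mul, pow_mul]
      simp
    · intro i _ hi
      rw [hlast, Pi.single_eq_of_ne hi]
      simp
    · simp
  rw [← hlap, Matrix.det_mul, LinearMap.det_toMatrix', hdet, abs_mul, straightenFactor, if_neg h0,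
    inv_mul_cancel_left₀ (det_straighten_ne_zero v)]

end Straighten

/-! ### The symmetrized volume formula. -/

section Main

variable {d : ℕ}

/-- Invariance of a functional under the permutations of the first `n` steps. -/
def IsStepInvariant (n : ℕ) (Φ : ((ℕ → Fin d → ℝ) → ℝ) →ₗ[ℝ] ℝ) : Prop :=
  ∀ τ : Equiv.Perm ℕ, (∀ k, n ≤ k → τ k = k) → ∀ h : (ℕ → Fin d → ℝ) → ℝ,
    Φ (fun x => h fun i => x (τ i)) = Φ h

/-- The functional on functions of walks in dimension `d` obtained by projecting the steps along
the sum of the first `N` of them. -/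
noncomputable def shadowFunctional (N : ℕ) (Φ : ((ℕ → Fin (d + 1) → ℝ) → ℝ) →ₗ[ℝ] ℝ) :
    ((ℕ → Fin d → ℝ) → ℝ) →ₗ[ℝ] ℝ where
  toFun h := Φ fun x => straightenFactor (∑ i ∈ Finset.range N, x i) *
    h fun i => shadow (∑ i ∈ Finset.range N, x i) (x i)
  map_add' h h' := by
    rw [← map_add]; congr 1; ext x; simp [mul_add]
  map_smul' c h := by
    rw [RingHom.id_apply, ← map_smul]; congr 1; ext x; simp [mul_left_comm]

lemma sum_range_perm {E : Type*} [AddCommMonoid E] {N : ℕ} {τ : Equiv.Perm ℕ}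
    (hτ : ∀ k, N ≤ k → τ k = k) (x : ℕ → E) :
    ∑ i ∈ Finset.range N, x (τ i) = ∑ i ∈ Finset.range N, x i := by
  refine Finset.sum_equiv τ (fun i => ?_) fun i _ => rfl
  simp only [Finset.mem_range]
  by_cases h : i < N
  · simp only [h, true_iff]
    by_contra! h'
    have := τ.injective (hτ _ h')
    omega
  · simp [h, hτ i (not_lt.1 h)]

lemma IsStepInvariant.mono {n N : ℕ} (h : n ≤ N) {Φ : ((ℕ → Fin d → ℝ) → ℝ) →ₗ[ℝ] ℝ}
    (hΦ : IsStepInvariant N Φ) : IsStepInvariant n Φ :=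
  fun τ hτ => hΦ τ fun k hk => hτ k (h.trans hk)

/-- The direction of projection is a symmetric function of the first `N` steps, so permuting them
commutes with projecting. -/
lemma IsStepInvariant.shadowFunctional {N : ℕ} {Φ : ((ℕ → Fin (d + 1) → ℝ) → ℝ) →ₗ[ℝ] ℝ}
    (hΦ : IsStepInvariant N Φ) : IsStepInvariant N (shadowFunctional N Φ) := by
  intro τ hτ h
  have := hΦ τ hτ fun x => straightenFactor (∑ i ∈ Finset.range N, x i) *
    h fun i => shadow (∑ i ∈ Finset.range N, x i) (x i)
  simp only [sum_range_perm hτ] at this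
  exact this

/-- The mean volume of the hull of a walk, over an arbitrary averaging functional that is invariant
under permutations of the steps. -/
theorem map_volume_walkHull (d : ℕ) : ∀ (n : ℕ) (Φ : ((ℕ → Fin d → ℝ) → ℝ) →ₗ[ℝ] ℝ),
    IsStepInvariant n Φ → Φ (fun x => volume.real (walkHull x n)) =
      (d ! : ℝ)⁻¹ * ∑ j ∈ stepTuples d n,
        Φ (fun x => |(blockMatrix j x).det|) / ∏ m, (j m : ℝ) := by
  induction d with
  | zero =>
    intro n Φ _
    have h1 : ∀ x : ℕ → Fin 0 → ℝ, volume.real (walkHull x n) = 1 := by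
      intro x
      have : walkHull x n = Set.univ :=
        Set.Nonempty.eq_univ (Set.Nonempty.convexHull ⟨_, 0, by simp, rfl⟩)
      rw [this]
      simp [measureReal_def, volume_pi]
    have h2 : stepTuples 0 n = {Fin.elim0} := by
      ext j
      simp [mem_stepTuples, Subsingleton.elim j Fin.elim0]
    simp [h1, h2]
  | succ d ihd =>
    intro n
    induction n with
    | zero =>
      intro Φ _
      have h1 : ∀ x : ℕ → Fin (d + 1) → ℝ, volume.real (walkHull x 0) = 0 := by
        intro x
        have : Set.Iic 0 = ({0} : Set ℕ) := by ext; simp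
        simp [walkHull, measureReal_def, this]
      have h2 : stepTuples (d + 1) 0 = ∅ := by
        ext j
        simp only [mem_stepTuples, Finset.notMem_empty, iff_false, not_and, not_le]
        exact fun h => lt_of_lt_of_le (h 0)
          (Finset.single_le_sum (fun _ _ => Nat.zero_le _) (Finset.mem_univ 0))
      simp only [h1, h2, Finset.sum_empty, mul_zero]
      exact map_zero Φ
    | succ n ihn =>
      intro Φ hΦ
      set a : (Fin (d + 1) → ℕ) → ℝ := fun J => Φ fun x => |(blockMatrix J x).det| with ha
      have hshift : ∀ k l, n + 1 ≤ l → (cyclicShift (n + 1) ^ k) l = l :=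
        fun k l hl => cyclicShift_pow_of_ge k hl
      have hrot : ∀ J ∈ exactTuples (d + 1) (n + 1),
          a (J ∘ finRotate (d + 1)) / ∏ m, ((J ∘ finRotate (d + 1)) m : ℝ) =
            a J / ∏ m, (J m : ℝ) := by
        intro J hJ
        congr 1
        · rw [ha]
          simp only
          rw [← hΦ _ (hshift (J 0))]
          congr 1
          ext x
          rw [← (mem_exactTuples.1 hJ).2]
          exact abs_det_blockMatrix_comp_finRotate J x
        · exact Equiv.prod_comp (finRotate (d + 1)) fun m => (J m : ℝ)
      -- By invariance, `Φ` takes the same value on all `n + 1` terms of the rotation identity. The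
      -- smaller hull is rotated by `n + 1` steps too, so invariance for `n` alone would not
      -- suffice.
      have hgain : (n + 1 : ℝ) * (Φ (fun x => volume.real (walkHull x (n + 1))) -
          Φ (fun x => volume.real (walkHull x n))) =
          shadowFunctional (n + 1) Φ fun x => volume.real (walkHull x n) := by
        have h : (fun x : ℕ → Fin (d + 1) → ℝ =>
            straightenFactor (∑ i ∈ Finset.range (n + 1), x i) *
            volume.real (walkHull (fun i => shadow (∑ i ∈ Finset.range (n + 1), x i) (x i)) n)) =
            ∑ k ∈ Finset.range (n + 1),
              ((fun x => volume.real (walkHull (fun i => x ((cyclicShift (n + 1) ^ k) i)) (n + 1)))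
              - fun x => volume.real
                (walkHull (fun i => x ((cyclicShift (n + 1) ^ (k + 1)) i)) n)) := by
          ext x
          rw [← volume_sweep_walkHull_diff, ← sum_volume_walkHull_cyclicShift]
          simp
        change _ = Φ _
        rw [h, map_sum]
        simp only [map_sub]
        rw [Finset.sum_congr rfl fun k _ => by
          rw [hΦ _ (hshift k) fun x => volume.real (walkHull x (n + 1)),
            hΦ _ (hshift (k + 1)) fun x => volume.real (walkHull x n)]]
        simp [mul_sub]
      have hIH := ihd n (shadowFunctional (n + 1) Φ) (hΦ.shadowFunctional.mono (Nat.le_succ n))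
      -- The product over `j` lacks the new last length; this is where the weight `J (Fin.last d)`
      -- comes from.
      have hterm : ∀ j ∈ stepTuples d n, shadowFunctional (n + 1) Φ
          (fun x => |(blockMatrix j x).det|) / ∏ m, (j m : ℝ) =
          (fun J : Fin (d + 1) → ℕ => (J (Fin.last d) : ℝ) * (a J / ∏ m, (J m : ℝ)))
            (Fin.snoc j (n + 1 - ∑ m, j m)) := by
        intro j hj
        have hj' := (mem_stepTuples.1 hj).2
        have hr : (0 : ℝ) < ((n + 1 - ∑ m, j m : ℕ) : ℝ) := by
          exact_mod_cast (by omega : 0 < n + 1 - ∑ m, j m)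
        have hval : shadowFunctional (n + 1) Φ (fun x => |(blockMatrix j x).det|) =
            a (Fin.snoc j (n + 1 - ∑ m, j m)) := by
          change Φ _ = Φ _
          congr 1
          ext x
          rw [abs_det_blockMatrix_snoc, Nat.add_sub_of_le (by omega)]
        rw [hval]
        simp only [Fin.prod_univ_castSucc, Fin.snoc_castSucc, Fin.snoc_last]
        field_simp
      rw [Finset.sum_congr rfl hterm, sum_stepTuples_snoc fun J : Fin (d + 1) → ℕ =>
        (J (Fin.last d) : ℝ) * (a J / ∏ m, (J m : ℝ))] at hIH
      have hsym := sum_exactTuples_mul_last (fun J => a J / ∏ m, (J m : ℝ)) hrot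
      have hn : (n + 1 : ℝ) ≠ 0 := by positivity
      have hd : (d + 1 : ℝ) ≠ 0 := by positivity
      rw [sum_stepTuples_succ, mul_add, ← ihn Φ (hΦ.mono (Nat.le_succ n))]
      rw [hIH] at hgain
      have : Φ (fun x => volume.real (walkHull x (n + 1))) -
          Φ (fun x => volume.real (walkHull x n)) =
          ((d + 1)! : ℝ)⁻¹ * ∑ J ∈ exactTuples (d + 1) (n + 1), a J / ∏ m, (J m : ℝ) := by
        apply mul_left_cancel₀ hn
        rw [hgain, Nat.factorial_succ]
        push_cast at hsym ⊢
        generalize (∑ J ∈ exactTuples (d + 1) (n + 1), (J (Fin.last d) : ℝ) *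
          (a J / ∏ m, (J m : ℝ))) = A at hsym ⊢
        generalize (∑ J ∈ exactTuples (d + 1) (n + 1), a J / ∏ m, (J m : ℝ)) = B at hsym ⊢
        field_simp
        linear_combination hsym
      linarith

end Main

/-! ### Summation over permutations of the steps. -/

section Symmetrization

variable {d : ℕ}

/-- Summation over all rearrangements of the first `n` steps of `x`. -/
noncomputable def sumPerm (n : ℕ) (x : ℕ → Fin d → ℝ) : ((ℕ → Fin d → ℝ) → ℝ) →ₗ[ℝ] ℝ where
  toFun h := ∑ σ : Equiv.Perm {i // i ∈ Finset.range n}, h fun i => x (Equiv.Perm.ofSubtype σ i)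
  map_add' h h' := by simp [Finset.sum_add_distrib]
  map_smul' c h := by simp [Finset.mul_sum]

lemma isStepInvariant_sumPerm (n : ℕ) (x : ℕ → Fin d → ℝ) : IsStepInvariant n (sumPerm n x) := by
  intro τ hτ h
  have hiff : ∀ i, τ i ∈ Finset.range n ↔ i ∈ Finset.range n := by
    intro i
    simp only [Finset.mem_range]
    rcases lt_or_ge i n with hi | hi
    · simp only [hi, iff_true]
      by_contra! h'
      have := τ.injective (hτ _ h')
      omega
    · simp [hτ i hi]
  have hof : Equiv.Perm.ofSubtype (τ.subtypePerm hiff) = τ :=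
    Equiv.Perm.ofSubtype_subtypePerm hiff fun i hi => by
      by_contra hi'
      exact hi (hτ i (by simpa using hi'))
  change ∑ σ : Equiv.Perm {i // i ∈ Finset.range n}, h _ = ∑ σ, h _
  refine Eq.trans ?_ (Equiv.sum_comp (Equiv.mulRight (τ.subtypePerm hiff)) _)
  refine Finset.sum_congr rfl fun σ _ => ?_
  simp [hof]

end Symmetrization

/-! ### Measurability of the volume and the determinants. -/

section Measurability

variable {d : ℕ}

lemma convexHull_range_eq_image_stdSimplex {ι E : Type*} [Fintype ι] [AddCommGroup E] [Module ℝ E]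
    (v : ι → E) :
    convexHull ℝ (Set.range v) = (fun w : ι → ℝ => ∑ i, w i • v i) '' stdSimplex ℝ ι := by
  classical
  have h := (Fintype.linearCombination ℝ v).image_convexHull
    (Set.range fun i j : ι => if i = j then (1 : ℝ) else 0)
  rw [convexHull_basis_eq_stdSimplex, ← Set.range_comp] at h
  have h2 : (Fintype.linearCombination ℝ v ∘ fun i j : ι => if i = j then (1 : ℝ) else 0) = v := by
    ext i
    simp [Fintype.linearCombination_apply]
  rw [h2] at h
  rw [← h]
  rfl

/-- The pairs (steps, point of the hull) form a closed set, as the image of a closed set under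
projection along the compact simplex of weights. The volume of its sections is then measurable. -/
lemma measurable_volume_walkHull (n : ℕ) :
    Measurable fun x : ℕ → Fin d → ℝ => volume (walkHull x n) := by
  have hcl : IsClosed {p : (ℕ → Fin d → ℝ) × (Fin d → ℝ) | p.2 ∈ walkHull p.1 n} := by
    have h : {p : (ℕ → Fin d → ℝ) × (Fin d → ℝ) | p.2 ∈ walkHull p.1 n} =
        Prod.snd '' {q : stdSimplex ℝ (Fin (n + 1)) × (ℕ → Fin d → ℝ) × (Fin d → ℝ) |
          ∑ k, q.1.1 k • ∑ i ∈ Finset.range k, q.2.1 i = q.2.2} := by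
      ext ⟨x, z⟩
      have hr : (fun k => ∑ i ∈ Finset.range k, x i) '' Set.Iic n =
          Set.range fun k : Fin (n + 1) => ∑ i ∈ Finset.range k, x i := by
        ext y
        simp only [Set.mem_image, Set.mem_Iic, Set.mem_range]
        exact ⟨fun ⟨k, hk, h⟩ => ⟨⟨k, by omega⟩, h⟩, fun ⟨k, h⟩ => ⟨k, by omega, h⟩⟩
      simp [walkHull, hr, convexHull_range_eq_image_stdSimplex]
    rw [h]
    refine isClosedMap_snd_of_compactSpace _ (isClosed_eq ?_ (by fun_prop))
    refine continuous_finsetSum _ fun k _ => ?_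
    have h1 : Continuous fun q : stdSimplex ℝ (Fin (n + 1)) × (ℕ → Fin d → ℝ) × (Fin d → ℝ) =>
        q.1.1 k := (continuous_apply k).comp (continuous_subtype_val.comp continuous_fst)
    exact h1.smul (by fun_prop)
  exact measurable_measure_prodMk_left hcl.measurableSet

lemma measurable_abs_det_blockMatrix (j : Fin d → ℕ) :
    Measurable fun x : ℕ → Fin d → ℝ => |(blockMatrix j x).det| := by
  refine Continuous.measurable (continuous_abs.comp (Continuous.matrix_det ?_))
  unfold blockMatrix blockSum
  refine continuous_matrix fun i m => ?_
  simp only [Matrix.of_apply, Finset.sum_apply]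
  fun_prop

end Measurability

/-! ### Exchangeability and the joint law of the block sums. -/

section Law

variable {Ω : Type*} [MeasurableSpace Ω] {P : Measure Ω} [IsProbabilityMeasure P]
  {E : Type*} [MeasurableSpace E] {X : ℕ → Ω → E}

/-- The law does not depend on `g`, which yields both exchangeability and the laws of blocks. -/
lemma map_comp_injective_eq_infinitePi (hX : ∀ i, Measurable (X i)) (hi : iIndepFun X P)
    (hid : ∀ i, IdentDistrib (X i) (X 0) P P) {ι : Type*} {g : ι → ℕ}
    (hg : Function.Injective g) :
    P.map (fun ω i => X (g i) ω) = Measure.infinitePi fun _ : ι => P.map (X 0) := by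
  rw [(iIndepFun_iff_map_fun_eq_infinitePi_map fun i => hX (g i)).1 (hi.precomp hg)]
  congr 1
  ext1 i
  exact (hid (g i)).map_eq

lemma identDistrib_comp_injective (hX : ∀ i, Measurable (X i)) (hi : iIndepFun X P)
    (hid : ∀ i, IdentDistrib (X i) (X 0) P P) {ι : Type*} {g g' : ι → ℕ}
    (hg : Function.Injective g) (hg' : Function.Injective g') :
    IdentDistrib (fun ω i => X (g i) ω) (fun ω i => X (g' i) ω) P P :=
  ⟨(measurable_pi_lambda _ fun i => hX (g i)).aemeasurable,
    (measurable_pi_lambda _ fun i => hX (g' i)).aemeasurable, by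
    rw [map_comp_injective_eq_infinitePi hX hi hid hg,
      map_comp_injective_eq_infinitePi hX hi hid hg']⟩

lemma blockStart_add_le {d : ℕ} (j : Fin d → ℕ) {m m' : Fin d} (h : m < m') :
    blockStart j m + j m ≤ blockStart j m' := by
  rw [blockStart, blockStart, ← Finset.add_sum_erase _ _ (Finset.mem_univ m),
    ← Finset.add_sum_erase (s := Finset.univ) (fun l => if l < m' then j l else 0)
      (Finset.mem_univ m), if_pos h, if_neg (lt_irrefl m), zero_add, add_comm]
  gcongr with l hl
  split_ifs with h1 h2
  · exact le_rfl
  · exact absurd (h1.trans h) h2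
  · exact Nat.zero_le _
  · exact le_rfl

lemma injective_blockStart_add {d : ℕ} (j : Fin d → ℕ) :
    Function.Injective fun p : (m : Fin d) × Fin (j m) => blockStart j p.1 + (p.2 : ℕ) := by
  rintro ⟨m, k⟩ ⟨m', k'⟩ h
  simp only at h
  have := k.2
  have := k'.2
  rcases lt_trichotomy m m' with h1 | rfl | h1
  · have := blockStart_add_le j h1; omega
  · have : k = k' := Fin.ext (by omega)
    rw [this]
  · have := blockStart_add_le j h1; omega

variable [AddCommGroup E] [MeasurableAdd₂ E]

lemma iIndepFun_blockSum (hX : ∀ i, Measurable (X i)) (hi : iIndepFun X P)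
    (hid : ∀ i, IdentDistrib (X i) (X 0) P P) {d : ℕ} (j : Fin d → ℕ) :
    iIndepFun (fun m ω => blockSum j (fun i => X i ω) m) P := by
  have : IsProbabilityMeasure (P.map (X 0)) := Measure.isProbabilityMeasure_map (hX 0).aemeasurable
  have h : iIndepFun (fun m ω (k : Fin (j m)) => X (blockStart j m + k) ω) P := by
    rw [iIndepFun_iff_map_fun_eq_infinitePi_map
      fun m => measurable_pi_lambda _ fun k => hX _]
    have h1 := map_comp_injective_eq_infinitePi hX hi hid (injective_blockStart_add j)
    -- Currying regroups the product law of all steps used as a product over blocks, which is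
    -- independence of the blocks.
    have h2 := Measure.infinitePi_map_piCurry
      (fun (m : Fin d) (_ : Fin (j m)) => P.map (X 0))
    rw [← h1, Measure.map_map (by fun_prop) (measurable_pi_lambda _ fun p => hX _)] at h2
    refine h2.trans ?_
    congr 1
    ext1 m
    refine (map_comp_injective_eq_infinitePi hX hi hid ?_).symm
    intro k k' hk
    exact Fin.ext (by simpa using hk)
  have := h.comp (fun m (y : Fin (j m) → E) => ∑ k, y k) fun m => by fun_prop
  convert this using 3 with m ω
  simp [blockSum, Finset.sum_range]

lemma identDistrib_blockSum (hX : ∀ i, Measurable (X i)) (hi : iIndepFun X P)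
    (hid : ∀ i, IdentDistrib (X i) (X 0) P P) {d : ℕ} (j : Fin d → ℕ) (m : Fin d) :
    IdentDistrib (fun ω => ∑ i ∈ Finset.range (j m), X i ω)
      (fun ω => blockSum j (fun i => X i ω) m) P P := by
  have h := (identDistrib_comp_injective hX hi hid (Fin.val_injective (n := j m))
    (g' := fun k : Fin (j m) => blockStart j m + k) fun k k' hk => Fin.ext (by simpa using hk)).comp
    (u := fun y : Fin (j m) → E => ∑ k, y k) (by fun_prop)
  convert h using 2 with ω ω
  · simp [Finset.sum_range]
  · simp [blockSum, Finset.sum_range]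

end Law

/-! ### Passage to Euclidean space and to `[0, ∞]`. -/

section Walk

variable {d : ℕ}

lemma ofReal_volume_walkHull (x : ℕ → Fin d → ℝ) (n : ℕ) :
    ENNReal.ofReal (volume.real (walkHull x n)) = volume (walkHull x n) :=
  ENNReal.ofReal_toReal (isCompact_walkHull x n).measure_lt_top.ne

lemma volume_pathHull_randomWalk {Ω : Type*} (X : ℕ → Ω → EuclideanSpace ℝ (Fin d)) (n : ℕ)
    (ω : Ω) : volume (pathHull (randomWalk X) n ω) =
      volume (walkHull (fun i => WithLp.ofLp (X i ω)) n) := by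
  rw [← (PiLp.volume_preserving_ofLp (Fin d)).measure_preimage
    (isCompact_walkHull _ n).measurableSet.nullMeasurableSet]
  congr 1
  have h := (WithLp.linearEquiv 2 ℝ (Fin d → ℝ)).symm.toLinearMap.image_convexHull
    ((fun k => ∑ i ∈ Finset.range k, WithLp.ofLp (X i ω)) '' Set.Iic n)
  rw [pathHull, walkHull]
  have h2 : {x | ∃ k ≤ n, x = randomWalk X k ω} = (WithLp.linearEquiv 2 ℝ (Fin d → ℝ)).symm ''
      ((fun k => ∑ i ∈ Finset.range k, WithLp.ofLp (X i ω)) '' Set.Iic n) := by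
    ext y
    simp only [Set.mem_image, Set.mem_Iic, exists_exists_and_eq_and, map_sum]
    refine exists_congr fun k => and_congr_right fun _ => ?_
    rw [eq_comm]
    rfl
  rw [h2]
  refine h.symm.trans ?_
  exact (WithLp.linearEquiv 2 ℝ (Fin d → ℝ)).symm.toEquiv.image_eq_preimage_symm _

/-- The symmetrized volume formula with extended nonnegative real values. -/
lemma sum_perm_volume_walkHull (x : ℕ → Fin d → ℝ) (n : ℕ) :
    ∑ σ : Equiv.Perm {i // i ∈ Finset.range n},
        volume (walkHull (fun i => x (Equiv.Perm.ofSubtype σ i)) n) =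
      (d ! : ℝ≥0∞)⁻¹ * ∑ j ∈ stepTuples d n,
        (∑ σ : Equiv.Perm {i // i ∈ Finset.range n}, ENNReal.ofReal
          |(blockMatrix j fun i => x (Equiv.Perm.ofSubtype σ i)).det|) / ∏ m, (j m : ℝ≥0∞) := by
  have h : ∑ σ : Equiv.Perm {i // i ∈ Finset.range n},
        volume.real (walkHull (fun i => x (Equiv.Perm.ofSubtype σ i)) n) =
      (d ! : ℝ)⁻¹ * ∑ j ∈ stepTuples d n,
        (∑ σ : Equiv.Perm {i // i ∈ Finset.range n},
          |(blockMatrix j fun i => x (Equiv.Perm.ofSubtype σ i)).det|) / ∏ m, (j m : ℝ) :=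
    map_volume_walkHull d n (sumPerm n x) (isStepInvariant_sumPerm n x)
  have hpos : ∀ j ∈ stepTuples d n, 0 < ∏ m, (j m : ℝ) := fun j hj =>
    Finset.prod_pos fun m _ => by exact_mod_cast (mem_stepTuples.1 hj).1 m
  have h' := congrArg ENNReal.ofReal h
  rw [ENNReal.ofReal_sum_of_nonneg fun _ _ => measureReal_nonneg,
    ENNReal.ofReal_mul (by positivity), ENNReal.ofReal_inv_of_pos (by positivity),
    ENNReal.ofReal_natCast, ENNReal.ofReal_sum_of_nonneg fun j hj =>
      div_nonneg (Finset.sum_nonneg fun _ _ => abs_nonneg _) (hpos j hj).le] at h'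
  simp only [ofReal_volume_walkHull] at h'
  rw [h']
  congr 1
  refine Finset.sum_congr rfl fun j hj => ?_
  rw [ENNReal.ofReal_div_of_pos (hpos j hj), ENNReal.ofReal_sum_of_nonneg fun _ _ => abs_nonneg _,
    ENNReal.ofReal_prod_of_nonneg fun _ _ => Nat.cast_nonneg _]
  simp

end Walk

/-! ### Taking expectations. -/

theorem corollary2 {Ω Ω' : Type*} [MeasurableSpace Ω] [MeasurableSpace Ω']
    (P : Measure Ω) [IsProbabilityMeasure P] (P' : Measure Ω') [IsProbabilityMeasure P']
    (d : ℕ) (hd : 1 ≤ d) (n : ℕ)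
    -- the i.i.d. increments of the walk; they charge no affine hyperplane
    (X : ℕ → Ω → EuclideanSpace ℝ (Fin d))
    (hX : ∀ i, Measurable (X i))
    (hX_indep : iIndepFun X P)
    (hX_ident : ∀ i, IdentDistrib (X i) (X 0) P P)
    (hX_hyp : ∀ h : Set (EuclideanSpace ℝ (Fin d)), IsAffineHyperplane h → P (X 0 ⁻¹' h) = 0)
    -- independent copies, on any probability space, of the whole walk
    (T : Fin d → ℕ → Ω' → EuclideanSpace ℝ (Fin d))
    (hT_indep : iIndepFun (fun m ω k => T m k ω) P')
    (hT_copy : ∀ m, IdentDistrib (fun ω k => T m k ω) (fun ω k => randomWalk X k ω) P' P) :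
    Measurable (fun ω => volume (pathHull (randomWalk X) n ω)) ∧
    ∫⁻ ω, volume (pathHull (randomWalk X) n ω) ∂P =
      (d ! : ℝ≥0∞)⁻¹ * ∑ j ∈ stepTuples d n,
        (∫⁻ ω, ENNReal.ofReal |(columnMatrix fun m => T m (j m) ω).det| ∂P') /
          ∏ m, (j m : ℝ≥0∞) := by
  set x : Ω → ℕ → Fin d → ℝ := fun ω i => WithLp.ofLp (X i ω) with hx
  have hxm : Measurable x := measurable_pi_lambda _ fun i =>
    (PiLp.volume_preserving_ofLp (Fin d)).measurable.comp (hX i)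
  simp_rw [volume_pathHull_randomWalk]
  refine ⟨(measurable_volume_walkHull n).comp hxm, ?_⟩
  have hperm : ∀ (σ : Equiv.Perm ℕ) (F : (ℕ → Fin d → ℝ) → ℝ≥0∞), Measurable F →
      ∫⁻ ω, F (fun i => x ω (σ i)) ∂P = ∫⁻ ω, F (x ω) ∂P := by
    intro σ F hF
    refine ((identDistrib_comp_injective hX hX_indep hX_ident σ.injective
      Function.injective_id).comp (u := fun y => F fun i => WithLp.ofLp (y i)) ?_).lintegral_eq
    exact hF.comp (measurable_pi_lambda _ fun i =>
      (PiLp.volume_preserving_ofLp (Fin d)).measurable.comp (measurable_pi_apply i))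
  have hxσ : ∀ σ : Equiv.Perm ℕ, Measurable fun ω i => x ω (σ i) := fun σ =>
    measurable_pi_lambda _ fun i => (measurable_pi_apply (σ i)).comp hxm
  -- Independent copies at times `j m` have the joint law of the sums over disjoint blocks of a
  -- single walk.
  have hdet : ∀ j : Fin d → ℕ,
      ∫⁻ ω, ENNReal.ofReal |(columnMatrix fun m => T m (j m) ω).det| ∂P' =
        ∫⁻ ω, ENNReal.ofReal |(blockMatrix j (x ω)).det| ∂P := by
    intro j
    have hm : Measurable fun v : Fin d → EuclideanSpace ℝ (Fin d) =>
        ENNReal.ofReal |(columnMatrix v).det| := by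
      refine ENNReal.measurable_ofReal.comp (Continuous.measurable
        (continuous_abs.comp (Continuous.matrix_det ?_)))
      unfold columnMatrix
      refine continuous_matrix fun i m => ?_
      simp only [Matrix.of_apply]
      fun_prop
    have hone : ∀ m, IdentDistrib (fun ω => T m (j m) ω)
        (fun ω => blockSum j (fun i => X i ω) m) P' P := fun m =>
      ((hT_copy m).comp (measurable_pi_apply (j m))).trans
        (identDistrib_blockSum hX hX_indep hX_ident j m)
    have hTj : iIndepFun (fun m ω => T m (j m) ω) P' :=
      hT_indep.comp (fun m (y : ℕ → EuclideanSpace ℝ (Fin d)) => y (j m))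
        fun m => measurable_pi_apply (j m)
    have hid := (IdentDistrib.pi hone hTj
      (iIndepFun_blockSum hX hX_indep hX_ident j)).comp hm
    refine hid.lintegral_eq.trans (lintegral_congr fun ω => ?_)
    simp only [Function.comp_apply]
    congr 3
    ext i m
    simp [columnMatrix, blockMatrix, blockSum, hx]
  have hvm : ∀ σ : Equiv.Perm ℕ, Measurable fun ω => volume (walkHull (fun i => x ω (σ i)) n) :=
    fun σ => (measurable_volume_walkHull n).comp (hxσ σ)
  have hmain := lintegral_congr (μ := P) fun ω => sum_perm_volume_walkHull (x ω) n
  rw [lintegral_finsetSum _ fun σ _ => hvm _,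
    Finset.sum_congr rfl fun σ _ => hperm _ _ (measurable_volume_walkHull n)] at hmain
  have hdm : ∀ (j : Fin d → ℕ), Measurable fun y : ℕ → Fin d → ℝ =>
      ENNReal.ofReal |(blockMatrix j y).det| := fun j =>
    ENNReal.measurable_ofReal.comp (measurable_abs_det_blockMatrix j)
  have hdσ : ∀ (j : Fin d → ℕ) (σ : Equiv.Perm ℕ), Measurable fun ω =>
      ENNReal.ofReal |(blockMatrix j fun i => x ω (σ i)).det| := fun j σ => (hdm j).comp (hxσ σ)
  have hsm : ∀ j : Fin d → ℕ, Measurable fun ω => ∑ σ : Equiv.Perm {i // i ∈ Finset.range n},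
      ENNReal.ofReal |(blockMatrix j fun i => x ω (Equiv.Perm.ofSubtype σ i)).det| := fun j =>
    Finset.measurable_sum _ fun σ _ => hdσ j _
  rw [lintegral_const_mul _ (Finset.measurable_sum _ fun j _ => (hsm j).div_const _),
    lintegral_finsetSum _ fun j _ => (hsm j).div_const _] at hmain
  have hj : ∀ j ∈ stepTuples d n, ∫⁻ ω, (∑ σ : Equiv.Perm {i // i ∈ Finset.range n},
      ENNReal.ofReal |(blockMatrix j fun i => x ω (Equiv.Perm.ofSubtype σ i)).det|) /
        ∏ m, (j m : ℝ≥0∞) ∂P = (Fintype.card (Equiv.Perm {i // i ∈ Finset.range n}) : ℝ≥0∞) *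
      ((∫⁻ ω, ENNReal.ofReal |(columnMatrix fun m => T m (j m) ω).det| ∂P') /
          ∏ m, (j m : ℝ≥0∞)) := by
    intro j _
    simp only [div_eq_mul_inv]
    rw [lintegral_mul_const _ (hsm j), lintegral_finsetSum _ fun σ _ => hdσ j _,
      Finset.sum_congr rfl fun σ _ => hperm _ _ (hdm j), hdet]
    simp [mul_assoc]
  rw [Finset.sum_congr rfl hj, ← Finset.mul_sum, mul_left_comm, Finset.sum_const, nsmul_eq_mul,
    Finset.card_univ] at hmain
  -- Only the finite nonzero number of permutations is cancelled, so infinite expectations do no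
  -- harm.
  exact (ENNReal.mul_right_inj (by simp [Fintype.card_ne_zero]) (ENNReal.natCast_ne_top _)).1 hmain
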